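/- Write $(a)_k=a(a+1)\cdots(a+k-1)$. Let $\alpha,\beta,\gamma\in\mathbb{C}$ with $\gamma\notin\{0,-1,-2,\dots\}$, let $m_1,\dots,m_r$ be positive integers, $n=m_1+\cdots+m_r$, and let $e_1,\dots,e_r\in\mathbb{C}$ with $(e_i)_{m_i}\neq 0$ for all $i$ (so in particular $e_i\ne 0$). For $e\in\mathbb{C}$ and a positive integer $m$ with $(e)_m\neq0$, a pair of an upper parameter $e+m$ and a lower parameter $e$ in a hypergeometric series contributes to the $k$-th coefficient the factor $\frac{(e+m)_k}{(e)_k}=\frac{(e+k)_m}{(e)_m}$, where the right-hand side is the definition when $e$ is a negative integer. Put $$P(k)=\prod_{i=1}^r\frac{(e_i+k)_{m_i}}{(e_i)_{m_i}},\qquad D=\sum_{j=0}^{n}\frac{\Delta^jP(0)}{j!}\,(\alpha)_j(\beta)_j\,(\gamma-\alpha-\beta-n)_{n-j},$$ where $\Delta P(k)=P(k+1)-P(k)$. Assume $(\gamma-\beta-n)_n\neq0$. 1. If $(\gamma-\alpha-n)_n\neq 0$ and $D\neq0$, then there are $f_1,\dots,f_n\in\mathbb{C}\setminus\{0\}$ such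 that for all $|x|<1$ both series below converge absolutely and $${}_{r+2}F_{r+1}\left(\begin{array}{c}\alpha,\beta,e_1+m_1,\dots,e_r+m_r\\ \gamma,e_1,\dots,e_r\end{array};x\right)=(1-x)^{\gamma-\alpha-\beta-n}\,{}_{n+2}F_{n+1}\left(\begin{array}{c}\gamma-\alpha-n,\gamma-\beta-n,f_1+1,\dots,f_n+1\\ \gamma,f_1,\dots,f_n\end{array};x\right).$$ 2. If $(e_i-\beta)_{m_i}\neq0$ for all $i$, then there are $f_1,\dots,f_n\in\mathbb{C}\setminus\{0\}$ (not necessarily those of part 1) such that for all $x$ with $|x|<1$ and $|x/(x-1)|<1$ both series below converge absolutely and $${}_{r+2}F_{r+1}\left(\begin{array}{c}\alpha,\beta,e_1+m_1,\dots,e_r+m_r\\ \gamma,e_1,\dots,e_r\end{array};x\right)=(1-x)^{-\alpha}\,{}_{n+2}F_{n+1}\left(\begin{array}{c}\alpha,\gamma-\beta-n,f_1+1,\dots,f_n+1\\ \gamma,f_1,\dots,f_n\end{array};\frac{x}{x-1}\right).$$ Powers of $1-x$ are principal values. -/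

import Mathlib

/-- The Pochhammer symbol `(a)_k = a (a + 1) ⋯ (a + k - 1)`. -/
noncomputable def poch (a : ℂ) (k : ℕ) : ℂ :=
  (ascPochhammer ℂ k).eval a

/-- The generalized hypergeometric series `ₚF_q(a; b; x)`, for lower parameters `b` none of which
is a nonpositive integer. -/
noncomputable def genHypergeometric {p q : ℕ} (a : Fin p → ℂ) (b : Fin q → ℂ) (x : ℂ) : ℂ :=
  ∑' k : ℕ, (∏ i, poch (a i) k) / ((∏ j, poch (b j) k) * (k.factorial : ℂ)) * x ^ k

/-- The product over `i` of the ratios `(e i + m i)_k / (e i)_k`, each written as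
`(e i + k)_{m i} / (e i)_{m i}`. The two agree if `e i` is not a nonpositive integer, and the second
makes sense as soon as `(e i)_{m i} ≠ 0` (for `m i = 1`: as soon as `e i ≠ 0`). -/
noncomputable def shiftFactor {r : ℕ} (e : Fin r → ℂ) (m : Fin r → ℕ) (k : ℕ) : ℂ :=
  ∏ i, poch (e i + k) (m i) / poch (e i) (m i)

/-- The `k`-th term of the series
`ᵣ₊₂Fᵣ₊₁(α, β, e₁ + m₁, …, eᵣ + mᵣ; γ, e₁, …, eᵣ; x)`. -/
noncomputable def shiftedHypTerm {r : ℕ} (α β γ : ℂ) (e : Fin r → ℂ) (m : Fin r → ℕ)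
    (x : ℂ) (k : ℕ) : ℂ :=
  poch α k * poch β k / (poch γ k * (k.factorial : ℂ)) * shiftFactor e m k * x ^ k

/-- The function `ᵣ₊₂Fᵣ₊₁(α, β, e₁ + m₁, …, eᵣ + mᵣ; γ, e₁, …, eᵣ; x)`. -/
noncomputable def shiftedHyp {r : ℕ} (α β γ : ℂ) (e : Fin r → ℂ) (m : Fin r → ℕ) (x : ℂ) : ℂ :=
  ∑' k : ℕ, shiftedHypTerm α β γ e m x k

/-- The number `∑_{j ≤ n} (Δ^j P (0) / j!) (α)_j (β)_j (γ - α - β - n)_{n - j}`, where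
`P k = ∏ i, (e i + k)_{m i} / (e i)_{m i}`, `n = ∑ i, m i` and `Δ` is the forward difference. -/
noncomputable def eulerDiscriminant {r : ℕ} (α β γ : ℂ) (e : Fin r → ℂ) (m : Fin r → ℕ) : ℂ :=
  ∑ j ∈ Finset.range (∑ i, m i + 1),
    (fwdDiff 1)^[j] (shiftFactor e m) 0 / (j.factorial : ℂ) * poch α j * poch β j *
      poch (γ - α - β - ((∑ i, m i : ℕ) : ℂ)) (∑ i, m i - j)

theorem poch_ne_zero {a : ℂ} (ha : ∀ l : ℕ, a ≠ -(l : ℂ)) (k : ℕ) : poch a k ≠ 0 := by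
  intro h
  obtain ⟨l, _, hl⟩ := (ascPochhammer_eval_eq_zero_iff k a).1 h
  exact ha l (by rw [hl, neg_neg])

theorem poch_add (a : ℂ) (m k : ℕ) : poch a (m + k) = poch a m * poch (a + m) k := by
  simp [poch, ← ascPochhammer_mul, Polynomial.eval_comp]

/-- `shiftedHyp` is the generalized hypergeometric function if no `e i` is a nonpositive
integer. -/
theorem shiftedHyp_eq_genHypergeometric {r : ℕ} (α β γ : ℂ) (e : Fin r → ℂ) (m : Fin r → ℕ)
    (he : ∀ i, ∀ l : ℕ, e i ≠ -(l : ℂ)) (x : ℂ) :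
    shiftedHyp α β γ e m x =
      genHypergeometric (Fin.cons α (Fin.cons β fun i => e i + m i) : Fin (r + 2) → ℂ)
        (Fin.cons γ e : Fin (r + 1) → ℂ) x := by
  unfold shiftedHyp genHypergeometric
  congr 1
  funext k
  have h : shiftFactor e m k = (∏ i, poch (e i + m i) k) / ∏ i, poch (e i) k := by
    rw [shiftFactor, ← Finset.prod_div_distrib]
    refine Finset.prod_congr rfl fun i _ => ?_
    rw [div_eq_div_iff (poch_ne_zero (he i) _) (poch_ne_zero (he i) _), mul_comm, ← poch_add,
      mul_comm, ← poch_add, add_comm]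
  rw [shiftedHypTerm, h, Fin.prod_univ_succ, Fin.prod_univ_succ, Fin.prod_univ_succ]
  simp only [Fin.cons_zero, Fin.cons_succ]
  rw [div_mul_div_comm]
  congr 2 <;> ring

/-! The parameter pairs only multiply the `k`-th coefficient of a `₂F₁` by a polynomial `P k` of
degree at most `n` with `P 0 = 1`, so everything is proved for `₂F₁` series with polynomial weights.
Expanding `P` in falling factorials and applying Chu–Vandermonde to each term gives a Pfaff
transformation: the weight `P` becomes `pfaffWeight`, again of degree at most `n`
(`sum_antidiagonal_weightedHypCoeff`, `weightedHyp_pfaff`). Pfaff applied twice is Euler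
(`weightedHyp_euler`). A weight `Q` of degree exactly `n` with `Q 0 = 1` factors as `∏ (f j + k) / f
j`, with `-f j` its roots (`exists_shiftFactor_eq_eval`). The remaining hypotheses say that the
degree does not drop: by `pfaffWeight_coeff` the top coefficient is a nonzero multiple of `P (-β)`
for Pfaff, and of `D` for Euler. -/

/-- The `k`-th coefficient of a `₂F₁` series weighted by the values of a polynomial. -/
noncomputable def weightedHypCoeff (a b c : ℂ) (P : Polynomial ℂ) (k : ℕ) : ℂ :=
  poch a k * poch b k / (poch c k * (k.factorial : ℂ)) * P.eval (k : ℂ)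

/-! ### Pochhammer symbols and Chu–Vandermonde sums. -/

theorem poch_zero (a : ℂ) : poch a 0 = 1 := by simp [poch]

theorem poch_succ (a : ℂ) (k : ℕ) : poch a (k + 1) = poch a k * (a + k) :=
  ascPochhammer_succ_eval k a

theorem poch_succ_left (a : ℂ) (k : ℕ) : poch a (k + 1) = a * poch (a + 1) k := by
  rw [add_comm k 1, poch_add, poch_succ, poch_zero]; simp

theorem descPochhammer_eval_neg (a : ℂ) (j : ℕ) :
    (descPochhammer ℂ j).eval (-a) = (-1) ^ j * poch a j := by
  rw [poch, ← neg_neg a, ascPochhammer_eval_neg_eq_descPochhammer, neg_neg, ← mul_assoc,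
    ← mul_pow]
  simp

/-- The Chu–Vandermonde identity. -/
theorem sum_choose_mul_poch_div_poch (M : ℕ) : ∀ (b c : ℂ), (∀ l : ℕ, c ≠ -(l : ℂ)) →
    ∑ l ∈ Finset.range (M + 1), (-1) ^ l * (M.choose l : ℂ) * (poch b l / poch c l) =
      poch (c - b) M / poch c M := by
  induction M with
  | zero => intro b c _; simp [poch_zero]
  | succ M ih =>
    intro b c hc
    have hc' : ∀ l : ℕ, c + 1 ≠ -(l : ℂ) := fun l h => hc (l + 1) (by
      push_cast; linear_combination h)
    have hc0 : c ≠ 0 := by simpa using hc 0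
    have hcM : c + M ≠ 0 := fun h => hc M (by linear_combination h)
    -- Pascal's rule; the induction hypothesis then applies at `(b, c)` and at `(b + 1, c + 1)`.
    have key : ∑ l ∈ Finset.range (M + 1 + 1),
        (-1) ^ l * ((M + 1).choose l : ℂ) * (poch b l / poch c l) =
        ∑ l ∈ Finset.range (M + 1), (-1) ^ l * (M.choose l : ℂ) * (poch b l / poch c l) -
        b / c * ∑ l ∈ Finset.range (M + 1),
          (-1) ^ l * (M.choose l : ℂ) * (poch (b + 1) l / poch (c + 1) l) := by
      have h1 : ∑ l ∈ Finset.range (M + 1), (-1) ^ l * (M.choose l : ℂ) * (poch b l / poch c l) =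
          ∑ l ∈ Finset.range (M + 1 + 1), (-1) ^ l * (M.choose l : ℂ) * (poch b l / poch c l) := by
        rw [Finset.sum_range_succ _ (M + 1)]; simp
      rw [h1, Finset.sum_range_succ', Finset.sum_range_succ' _ (M + 1), Finset.mul_sum,
        add_sub_right_comm, ← Finset.sum_sub_distrib]
      simp only [Nat.choose_zero_right]
      congr 1
      refine Finset.sum_congr rfl fun l _ => ?_
      have := poch_ne_zero hc' l
      rw [Nat.choose_succ_succ, poch_succ_left, poch_succ_left]
      push_cast
      field_simp
      ring
    rw [key, ih b c hc, ih (b + 1) (c + 1) hc', add_sub_add_right_eq_sub, poch_succ (c - b),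
      ← mul_div_mul_right _ (poch c M) hcM, ← poch_succ c, poch_succ_left c]
    have := poch_ne_zero hc' M
    have h2 : c * poch (c + 1) M = poch c M * (c + M) := by rw [← poch_succ_left, poch_succ]
    field_simp
    ring

theorem choose_add_mul_descFactorial (j M l : ℕ) :
    (j + M).choose (j + l) * (j + l).descFactorial j = (j + M).descFactorial j * M.choose l := by
  have h := @Nat.choose_mul (j + M) (j + l) j (by omega)
  rw [Nat.descFactorial_eq_factorial_mul_choose, Nat.descFactorial_eq_factorial_mul_choose]
  simp only [Nat.add_sub_cancel_left] at h
  linear_combination j.factorial * h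

/-- This is Pfaff's transformation for one falling factorial as weight. Terms with `k < j` vanish
(so the truncated `k - j` is harmless), and `k = j + l` turns the rest into Chu–Vandermonde with
parameters `c - b` and `c + j`. -/
theorem sum_choose_mul_descFactorial_mul_poch (b c : ℂ) (hc : ∀ l : ℕ, c ≠ -(l : ℂ)) (j N : ℕ) :
    ∑ k ∈ Finset.range (N + 1), (-1) ^ k * (N.choose k : ℂ) / poch c k *
      ((-1) ^ j * poch b j * poch (c - b) (k - j) * (k.descFactorial j : ℂ)) =
      poch b N / poch c N * (N.descFactorial j : ℂ) := by
  rcases lt_or_ge N j with h | h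
  · rw [Nat.descFactorial_of_lt h]
    simp only [Nat.cast_zero, mul_zero]
    refine Finset.sum_eq_zero fun k hk => ?_
    rw [Nat.descFactorial_of_lt (by rw [Finset.mem_range] at hk; omega)]
    simp
  · obtain ⟨M, rfl⟩ := Nat.exists_eq_add_of_le h
    have hcj : ∀ l : ℕ, c + j ≠ -(l : ℂ) := fun l hl => hc (j + l) (by
      push_cast; linear_combination hl)
    rw [add_assoc, Finset.sum_range_add, Finset.sum_eq_zero, zero_add]
    · have hV := sum_choose_mul_poch_div_poch M (c - b) (c + j) hcj
      rw [show c + j - (c - b) = b + j by ring] at hV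
      rw [poch_add b, poch_add c, mul_div_mul_comm, ← hV, Finset.mul_sum, Finset.sum_mul]
      refine Finset.sum_congr rfl fun l _ => ?_
      have h1 := poch_ne_zero hc j
      have h2 := poch_ne_zero hcj l
      have h3 : (((j + M).choose (j + l) : ℕ) : ℂ) * ((j + l).descFactorial j : ℕ) =
          ((j + M).descFactorial j : ℕ) * (M.choose l : ℕ) := by
        exact_mod_cast choose_add_mul_descFactorial j M l
      have h4 : ((-1 : ℂ) ^ j) * (-1) ^ j = 1 := by rw [← mul_pow]; simp
      rw [poch_add c, Nat.add_sub_cancel_left, pow_add]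
      field_simp
      linear_combination (poch b j * poch (c - b) l) *
        (((j + M).choose (j + l) : ℂ) * ((j + l).descFactorial j : ℂ) * h4 + h3)
    · intro k hk
      rw [Nat.descFactorial_of_lt (by simpa using hk)]
      simp

/-! ### Newton expansion in falling factorials. -/

/-- The coefficients of a polynomial in the basis of falling factorials. -/
noncomputable def newtonCoeff (P : Polynomial ℂ) (j : ℕ) : ℂ :=
  (fwdDiff 1)^[j] (fun k : ℕ => P.eval (k : ℂ)) 0 / (j.factorial : ℂ)

theorem newtonCoeff_eq_zero {P : Polynomial ℂ} {j : ℕ} (h : P.natDegree < j) :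
    newtonCoeff P j = 0 := by
  have h0 := congrFun (Polynomial.fwdDiff_iter_eq_zero_of_degree_lt h) 0
  rw [fwdDiff_iter_eq_sum_shift] at h0
  rw [newtonCoeff, fwdDiff_iter_eq_sum_shift]
  simp only [zero_add, smul_eq_mul, mul_one, nsmul_eq_mul, Pi.zero_apply] at h0 ⊢
  rw [h0, zero_div]

theorem sum_newtonCoeff_mul_descFactorial {P : Polynomial ℂ} {n : ℕ} (h : P.natDegree ≤ n) (N : ℕ) :
    ∑ j ∈ Finset.range (n + 1), newtonCoeff P j * (N.descFactorial j : ℂ) = P.eval (N : ℂ) := by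
  have h1 := shift_eq_sum_fwdDiff_iter (1 : ℕ) (fun k : ℕ => P.eval (k : ℂ)) N 0
  simp only [zero_add, smul_eq_mul, mul_one, nsmul_eq_mul] at h1
  rw [h1]
  have h2 : ∀ j, (N.choose j : ℂ) * (fwdDiff 1)^[j] (fun k : ℕ => P.eval (k : ℂ)) 0 =
      newtonCoeff P j * (N.descFactorial j : ℂ) := fun j => by
    have := Nat.cast_ne_zero (R := ℂ).2 j.factorial_ne_zero
    rw [newtonCoeff, Nat.descFactorial_eq_factorial_mul_choose]
    push_cast
    field_simp
  simp only [h2]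
  -- Newton's formula sums to `N`, the claim to `n`; both sums extend by zeros to `n + N`.
  have e1 : ∀ a b : ℕ, (∀ j, a < j → newtonCoeff P j * (N.descFactorial j : ℂ) = 0) →
      ∑ j ∈ Finset.range (a + 1), newtonCoeff P j * (N.descFactorial j : ℂ) =
      ∑ j ∈ Finset.range (a + b + 1), newtonCoeff P j * (N.descFactorial j : ℂ) := by
    intro a b hab
    refine Finset.sum_subset (Finset.range_mono (by omega)) fun j _ hj => hab j ?_
    rw [Finset.mem_range] at hj; omega
  rw [e1 n N fun j hj => by rw [newtonCoeff_eq_zero (by omega), zero_mul],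
    e1 N n fun j hj => by rw [Nat.descFactorial_of_lt hj, Nat.cast_zero, mul_zero], add_comm n N]

open Polynomial in
theorem newton_expansion {P : Polynomial ℂ} {n : ℕ} (h : P.natDegree ≤ n) (z : ℂ) :
    P.eval z = ∑ j ∈ Finset.range (n + 1), newtonCoeff P j * (descPochhammer ℂ j).eval z := by
  have : P = ∑ j ∈ Finset.range (n + 1), C (newtonCoeff P j) * descPochhammer ℂ j := by
    refine Polynomial.eq_of_infinite_eval_eq _ _
      ((Set.infinite_range_of_injective (Nat.cast_injective (R := ℂ))).mono ?_)
    rintro _ ⟨N, rfl⟩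
    simp [eval_finsetSum, descPochhammer_eval_eq_descFactorial,
      sum_newtonCoeff_mul_descFactorial h]
  conv_lhs => rw [this]
  simp [eval_finsetSum]

/-! ### The transformed weight and Pfaff's transformation of coefficients. -/

open Polynomial in
/-- The weight that Pfaff's transformation attaches to the weight `P`. -/
noncomputable def pfaffWeight (b c : ℂ) (n : ℕ) (P : Polynomial ℂ) : Polynomial ℂ :=
  ∑ j ∈ Finset.range (n + 1), C (newtonCoeff P j * ((-1) ^ j * poch b j) / poch (c - b - n) n) *
    ((ascPochhammer ℂ (n - j)).comp (X + C (c - b - n)) * descPochhammer ℂ j)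

theorem pfaffWeight_eval (b c : ℂ) (n : ℕ) (P : Polynomial ℂ) (z : ℂ) :
    (pfaffWeight b c n P).eval z = (∑ j ∈ Finset.range (n + 1), newtonCoeff P j *
      ((-1) ^ j * poch b j) * poch (c - b - n + z) (n - j) * (descPochhammer ℂ j).eval z) /
        poch (c - b - n) n := by
  simp only [pfaffWeight, Polynomial.eval_finsetSum, Finset.sum_div, poch]
  refine Finset.sum_congr rfl fun j _ => ?_
  simp [Polynomial.eval_comp, add_comm z]
  ring

theorem pfaffWeight_eval_zero {b c : ℂ} {n : ℕ} (h : poch (c - b - n) n ≠ 0) (P : Polynomial ℂ) :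
    (pfaffWeight b c n P).eval 0 = P.eval 0 := by
  rw [pfaffWeight_eval, Finset.sum_range_succ', Finset.sum_eq_zero]
  · simp [newtonCoeff, poch_zero, h]
  · intro j _
    simp

open Polynomial in
theorem monic_pfaffWeight_factor (a : ℂ) {n j : ℕ} (hj : j ≤ n) :
    ((ascPochhammer ℂ (n - j)).comp (X + C a) * descPochhammer ℂ j).Monic ∧
    ((ascPochhammer ℂ (n - j)).comp (X + C a) * descPochhammer ℂ j).natDegree = n := by
  have h1 : ((ascPochhammer ℂ (n - j)).comp (X + C a)).Monic :=
    (monic_ascPochhammer ℂ _).comp_X_add_C a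
  refine ⟨h1.mul (monic_descPochhammer ℂ j), ?_⟩
  rw [h1.natDegree_mul (monic_descPochhammer ℂ j), natDegree_comp, natDegree_X_add_C,
    ascPochhammer_natDegree, descPochhammer_natDegree]
  omega

theorem natDegree_pfaffWeight_le (b c : ℂ) (n : ℕ) (P : Polynomial ℂ) :
    (pfaffWeight b c n P).natDegree ≤ n := by
  refine Polynomial.natDegree_sum_le_of_forall_le _ _ fun j hj => ?_
  refine (Polynomial.natDegree_C_mul_le _ _).trans
    (monic_pfaffWeight_factor _ ?_).2.le
  rw [Finset.mem_range] at hj; omega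

/-- Every summand is a scalar times a monic polynomial of degree `n`, and since `(-1) ^ j * poch b
j` is the falling factorial at `-b`, the scalars add up to the Newton expansion of `P` at `-b`. -/
theorem pfaffWeight_coeff (b c : ℂ) {n : ℕ} {P : Polynomial ℂ} (hP : P.natDegree ≤ n) :
    (pfaffWeight b c n P).coeff n = P.eval (-b) / poch (c - b - n) n := by
  rw [newton_expansion hP, pfaffWeight, Polynomial.finsetSum_coeff, Finset.sum_div]
  refine Finset.sum_congr rfl fun j hj => ?_
  obtain ⟨h1, h2⟩ := monic_pfaffWeight_factor (c - b - n) (n := n) (j := j)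
    (by rw [Finset.mem_range] at hj; omega)
  rw [Polynomial.coeff_C_mul, descPochhammer_eval_neg]
  rw [Polynomial.Monic, Polynomial.leadingCoeff, h2] at h1
  rw [h1, mul_one]

/-- For `j ≤ k`, `(c-b-n)_k (c-b-n+k)_{n-j}` and `(c-b-n)_n (c-b)_{k-j}` are two splittings of
`(c-b-n)_{n+k-j}`. -/
theorem poch_mul_pfaffWeight_eval {b c : ℂ} {n : ℕ} (h : poch (c - b - n) n ≠ 0)
    (P : Polynomial ℂ) (k : ℕ) :
    poch (c - b - n) k * (pfaffWeight b c n P).eval (k : ℂ) =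
      ∑ j ∈ Finset.range (n + 1), newtonCoeff P j *
        ((-1) ^ j * poch b j * poch (c - b) (k - j) * (k.descFactorial j : ℂ)) := by
  rw [pfaffWeight_eval, mul_div_assoc', div_eq_iff h, Finset.mul_sum, Finset.sum_mul]
  refine Finset.sum_congr rfl fun j hj => ?_
  rw [descPochhammer_eval_eq_descFactorial]
  rcases lt_or_ge k j with hk | hk
  · simp [Nat.descFactorial_of_lt hk]
  · have hj' : j ≤ n := by rw [Finset.mem_range] at hj; omega
    have h1 := poch_add (c - b - n) k (n - j)
    have h2 := poch_add (c - b - n) n (k - j)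
    rw [show k + (n - j) = n + (k - j) by omega, h2, sub_add_cancel] at h1
    linear_combination (-newtonCoeff P j * ((-1) ^ j * poch b j) * (k.descFactorial j : ℂ)) * h1

/-- Pfaff's transformation of weighted `₂F₁` series on the level of coefficients. -/
theorem sum_antidiagonal_weightedHypCoeff (a b c : ℂ) {n : ℕ} (hc : ∀ l : ℕ, c ≠ -(l : ℂ))
    (h : poch (c - b - n) n ≠ 0) {P : Polynomial ℂ} (hP : P.natDegree ≤ n) (N : ℕ) :
    ∑ p ∈ Finset.HasAntidiagonal.antidiagonal N, weightedHypCoeff a (c - b - n) c (pfaffWeight b c n P) p.1 *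
      (-1) ^ p.1 * (poch (a + p.1) p.2 / (p.2.factorial : ℂ)) = weightedHypCoeff a b c P N := by
  have hfac : ∀ i : ℕ, (i.factorial : ℂ) ≠ 0 := fun i =>
    Nat.cast_ne_zero (R := ℂ).2 i.factorial_ne_zero
  calc
    _ = ∑ p ∈ Finset.HasAntidiagonal.antidiagonal N, poch a N / (N.factorial : ℂ) *
        ∑ j ∈ Finset.range (n + 1), newtonCoeff P j * ((-1) ^ p.1 * (N.choose p.1 : ℂ) / poch c p.1 *
        ((-1) ^ j * poch b j * poch (c - b) (p.1 - j) * (p.1.descFactorial j : ℂ))) := by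
      refine Finset.sum_congr rfl fun p hp => ?_
      rw [Finset.HasAntidiagonal.mem_antidiagonal] at hp
      have h1 : ∑ j ∈ Finset.range (n + 1), newtonCoeff P j *
          ((-1) ^ p.1 * (N.choose p.1 : ℂ) / poch c p.1 *
          ((-1) ^ j * poch b j * poch (c - b) (p.1 - j) * (p.1.descFactorial j : ℂ))) =
          (-1) ^ p.1 * (N.choose p.1 : ℂ) / poch c p.1 *
          (poch (c - b - n) p.1 * (pfaffWeight b c n P).eval (p.1 : ℂ)) := by
        rw [poch_mul_pfaffWeight_eval h, Finset.mul_sum]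
        exact Finset.sum_congr rfl fun j _ => by ring
      have h2 : (N.choose p.1 : ℂ) * (p.1.factorial : ℂ) * (p.2.factorial : ℂ) = N.factorial := by
        rw [← hp, Nat.choose_symm_add]
        exact_mod_cast Nat.add_choose_mul_factorial_mul_factorial p.1 p.2
      have := poch_ne_zero hc p.1
      have h3 : (N.choose p.1 : ℂ) = N.factorial / (p.1.factorial * p.2.factorial) := by
        rw [eq_div_iff (mul_ne_zero (hfac _) (hfac _)), ← h2, mul_assoc]
      have := hfac p.1
      have := hfac p.2
      have := hfac N
      rw [h1, weightedHypCoeff, ← hp, poch_add, hp, h3]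
      field_simp
    _ = poch a N / (N.factorial : ℂ) * ∑ j ∈ Finset.range (n + 1), newtonCoeff P j *
        (poch b N / poch c N * (N.descFactorial j : ℂ)) := by
      rw [← Finset.mul_sum, Finset.sum_comm]
      congr 1
      refine Finset.sum_congr rfl fun j _ => ?_
      rw [← Finset.mul_sum, ← sum_choose_mul_descFactorial_mul_poch b c hc,
        Finset.Nat.sum_antidiagonal_eq_sum_range_succ_mk]
    _ = _ := by
      have := poch_ne_zero hc N
      have := hfac N
      rw [weightedHypCoeff, ← sum_newtonCoeff_mul_descFactorial hP, Finset.mul_sum, Finset.mul_sum]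
      refine Finset.sum_congr rfl fun j _ => ?_
      field_simp

/-! ### Binomial series and rearrangement of the double series. -/

theorem hasSum_poch_div_factorial_mul_pow (a : ℂ) {x : ℂ} (hx : ‖x‖ < 1) :
    HasSum (fun l : ℕ => poch a l / (l.factorial : ℂ) * x ^ l) ((1 - x) ^ (-a)) := by
  have h := (Complex.one_div_one_sub_cpow_hasFPowerSeriesOnBall_zero a).hasSum (y := x)
    (by simpa [enorm_eq_nnnorm, ← NNReal.coe_lt_one] using hx)
  have hc : ∀ l : ℕ, Ring.choose (a + l - 1) l = poch a l / (l.factorial : ℂ) := fun l => by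
    rw [eq_div_iff (Nat.cast_ne_zero.2 l.factorial_ne_zero), Ring.choose,
      show a + l - 1 - l + 1 = a by ring, mul_comm, ← nsmul_eq_mul,
      Ring.factorial_nsmul_multichoose_eq_ascPochhammer,
      Polynomial.ascPochhammer_smeval_eq_eval, poch]
  simpa [hc, Complex.cpow_neg, mul_comm] using h

theorem norm_poch_le_ascFactorial {z : ℂ} {M : ℕ} (hz : ‖z‖ ≤ M) (l : ℕ) :
    ‖poch z l‖ ≤ (M.ascFactorial l : ℝ) := by
  induction l with
  | zero => simp [poch_zero]
  | succ l ih =>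
    rw [poch_succ, norm_mul, Nat.ascFactorial_succ, mul_comm, Nat.cast_mul]
    refine mul_le_mul ?_ ih (norm_nonneg _) (by positivity)
    push_cast
    exact (norm_add_le _ _).trans (by simpa using hz)

theorem norm_poch_div_factorial_le {a : ℂ} {M : ℕ} (ha : ‖a‖ ≤ M) (k l : ℕ) :
    ‖poch (a + k) l / (l.factorial : ℂ)‖ ≤ 2 ^ M * 2 ^ k * 2 ^ l := by
  have h1 : ‖a + k‖ ≤ ((M + k + 1 : ℕ) : ℝ) := by
    refine (norm_add_le _ _).trans ?_
    push_cast
    simp only [Complex.norm_natCast]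
    linarith
  have h2 := norm_poch_le_ascFactorial h1 l
  rw [Nat.ascFactorial_eq_factorial_mul_choose] at h2
  rw [norm_div, Complex.norm_natCast, div_le_iff₀ (by positivity)]
  refine h2.trans ?_
  rw [Nat.cast_mul, mul_comm, ← pow_add, ← pow_add]
  gcongr
  exact_mod_cast Nat.choose_le_two_pow _ _

/-- Expansion of `(1 - x) ^ (-a) * g (x / (x - 1))` in powers of `x`, for a power series `g`. -/
theorem hasSum_pfaff_expansion (a : ℂ) {u : ℕ → ℂ}
    (hu : ∀ z : ℂ, ‖z‖ < 1 → Summable fun k => u k * z ^ k) {x : ℂ} (hx : ‖x‖ < 1 / 2) :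
    HasSum (fun N => (∑ p ∈ Finset.HasAntidiagonal.antidiagonal N,
      u p.1 * (-1) ^ p.1 * (poch (a + p.1) p.2 / (p.2.factorial : ℂ))) * x ^ N)
      ((1 - x) ^ (-a) * ∑' k, u k * (x / (x - 1)) ^ k) := by
  have hx1 : (1 : ℂ) - x ≠ 0 := fun h => by
    rw [← sub_eq_zero.1 h] at hx; norm_num at hx
  obtain ⟨M, hM⟩ := exists_nat_ge ‖a‖
  let F : ℕ × ℕ → ℂ := fun p =>
    u p.1 * (-1) ^ p.1 * (poch (a + p.1) p.2 / (p.2.factorial : ℂ)) * x ^ (p.1 + p.2)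
  have hF : Summable F := by
    -- The bound `2 ^ M * 2 ^ k * 2 ^ l` on the binomial coefficients costs a factor 2 in each
    -- variable, hence `‖x‖ < 1 / 2`.
    have h1 : Summable fun k => ‖u k * (2 * x) ^ k‖ := (hu (2 * x) (by simp; linarith)).norm
    have h2 : Summable fun l : ℕ => (2 * ‖x‖) ^ l :=
      summable_geometric_of_lt_one (by positivity) (by linarith)
    refine Summable.of_norm_bounded
      ((h1.mul_of_nonneg h2 (fun _ => norm_nonneg _) fun _ => by positivity).mul_left (2 ^ M)) ?_
    rintro ⟨k, l⟩
    have h3 := norm_poch_div_factorial_le hM k l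
    calc ‖F (k, l)‖ = ‖u k‖ * ‖poch (a + k) l / (l.factorial : ℂ)‖ * ‖x‖ ^ (k + l) := by
          simp only [F, norm_mul, norm_pow, norm_neg, norm_one, one_pow, mul_one]
      _ ≤ ‖u k‖ * (2 ^ M * 2 ^ k * 2 ^ l) * ‖x‖ ^ (k + l) := by gcongr
      _ = _ := by
          simp only [norm_mul, norm_pow, Complex.norm_ofNat]
          ring
  -- Summing over `l` first gives binomial series; summing along antidiagonals gives the power
  -- series in `x`.
  have hk : ∀ k, HasSum (fun l => F (k, l)) ((1 - x) ^ (-a) * (u k * (x / (x - 1)) ^ k)) := by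
    intro k
    have h := (hasSum_poch_div_factorial_mul_pow (a + k) (x := x) (by linarith)).mul_left
      (u k * (-1) ^ k * x ^ k)
    have h1 : (fun l => F (k, l)) = fun l : ℕ => u k * (-1) ^ k * x ^ k *
        (poch (a + k) l / (l.factorial : ℂ) * x ^ l) := by
      funext l
      simp only [F]
      ring
    have h2 : (1 - x) ^ (-a) * (u k * (x / (x - 1)) ^ k) =
        u k * (-1) ^ k * x ^ k * (1 - x) ^ (-(a + k)) := by
      rw [neg_add, ← sub_eq_add_neg, Complex.cpow_sub _ _ hx1, Complex.cpow_natCast,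
        ← neg_sub 1 x, div_neg, neg_pow, div_pow]
      ring
    rwa [h1, h2]
  have htot : HasSum F ((1 - x) ^ (-a) * ∑' k, u k * (x / (x - 1)) ^ k) := by
    rw [← tsum_mul_left, ← (funext fun k => (hk k).tsum_eq : (fun k => ∑' l, F (k, l)) = _),
      ← hF.tsum_prod]
    exact hF.hasSum
  have hs := (Finset.HasAntidiagonal.sigmaAntidiagonalEquivProd (A := ℕ)).hasSum_iff.2 htot
  convert hs.sigma fun N => hasSum_fintype _ using 1
  funext N
  rw [Finset.sum_mul, ← Finset.sum_coe_sort]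
  refine Finset.sum_congr rfl fun p _ => ?_
  have := Finset.HasAntidiagonal.mem_antidiagonal.1 p.2
  simp [F, this]

/-! ### Convergence and analyticity. -/

theorem tendsto_ratio_add (a c : ℂ) :
    Filter.Tendsto (fun k : ℕ => (a + k) / (c + k)) Filter.atTop (nhds 1) := by
  have h : ∀ a : ℂ, Filter.Tendsto (fun k : ℕ => a / (k : ℂ) + 1) Filter.atTop (nhds 1) := fun a => by
    simpa using (tendsto_const_div_atTop_nhds_zero_nat a).add_const 1
  have h2 := (h a).div (h c) one_ne_zero
  rw [div_one] at h2
  refine h2.congr' ?_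
  filter_upwards [Filter.eventually_ge_atTop 1] with k hk
  have : (k : ℂ) ≠ 0 := Nat.cast_ne_zero.2 (by omega)
  simp only [Pi.div_apply]
  rw [div_add_one this, div_add_one this, div_div_div_cancel_right₀ this]

theorem summable_weightedHypCoeff (a b c : ℂ) (hc : ∀ l : ℕ, c ≠ -(l : ℂ)) (P : Polynomial ℂ)
    (z : ℂ) (hz : ‖z‖ < 1) : Summable fun k => weightedHypCoeff a b c P k * z ^ k := by
  -- The ratio test is run on monomial weights, because `P` may vanish at integers.
  have key : ∀ i : ℕ, Summable fun k : ℕ =>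
      poch a k * poch b k / (poch c k * (k.factorial : ℂ)) * (k : ℂ) ^ i * z ^ k := by
    intro i
    obtain ⟨ρ, hρ, hρ1⟩ := exists_between hz
    have hlim : Filter.Tendsto (fun k : ℕ => ‖(a + k) / (c + k) * ((b + k) / (1 + k)) *
        ((1 + k) / (0 + k)) ^ i * z‖) Filter.atTop (nhds ‖z‖) := by
      have := ((((tendsto_ratio_add a c).mul (tendsto_ratio_add b 1)).mul
        ((tendsto_ratio_add 1 0).pow i)).mul_const z).norm
      simpa using this
    refine summable_of_ratio_norm_eventually_le hρ1 ?_
    filter_upwards [hlim.eventually_le_const hρ, Filter.eventually_ge_atTop 1] with k hk hk1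
    refine le_trans (le_of_eq ?_) (mul_le_mul_of_nonneg_right hk (norm_nonneg _))
    rw [← norm_mul]
    congr 1
    have h1 : (k : ℂ) ≠ 0 := Nat.cast_ne_zero.2 (by omega)
    have h2 : (1 : ℂ) + k ≠ 0 := by rw [add_comm]; exact Nat.cast_add_one_ne_zero k
    have h3 := poch_ne_zero hc k
    have h4 : c + k ≠ 0 := fun h => hc k (by linear_combination h)
    have h5 : (k.factorial : ℂ) ≠ 0 := Nat.cast_ne_zero.2 k.factorial_ne_zero
    rw [poch_succ, poch_succ, poch_succ, Nat.factorial_succ, zero_add, div_pow]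
    push_cast
    rw [add_comm (k : ℂ) 1]
    field_simp
    ring
  have h := summable_sum (s := Finset.range (P.natDegree + 1)) fun i _ =>
    (key i).mul_left (P.coeff i)
  refine h.congr fun k => ?_
  rw [weightedHypCoeff, Polynomial.eval_eq_sum_range, Finset.mul_sum, Finset.sum_mul]
  exact Finset.sum_congr rfl fun i _ => by ring

theorem analyticOnNhd_tsum_mul_pow {u : ℕ → ℂ}
    (hu : ∀ z : ℂ, ‖z‖ < 1 → Summable fun k => u k * z ^ k) :
    AnalyticOnNhd ℂ (fun z => ∑' k, u k * z ^ k) (Metric.ball 0 1) := by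
  refine DifferentiableOn.analyticOnNhd (fun z hz => ?_) Metric.isOpen_ball
  rw [mem_ball_zero_iff] at hz
  obtain ⟨ρ, hρ, hρ1⟩ := exists_between hz
  have hρ0 : 0 ≤ ρ := (norm_nonneg z).trans hρ.le
  have hd : DifferentiableOn ℂ (fun z => ∑' k, u k * z ^ k) (Metric.ball 0 ρ) := by
    refine Complex.differentiableOn_tsum_of_summable_norm (u := fun k => ‖u k * (ρ : ℂ) ^ k‖)
      (hu ρ (by simpa [abs_of_nonneg hρ0] using hρ1)).norm (fun k => by fun_prop)
      Metric.isOpen_ball fun k w hw => ?_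
    rw [mem_ball_zero_iff] at hw
    rw [norm_mul, norm_mul, norm_pow, norm_pow, Complex.norm_real, Real.norm_of_nonneg hρ0]
    gcongr
  exact (hd.differentiableAt (Metric.isOpen_ball.mem_nhds (by simpa using hρ))).differentiableWithinAt

/-- The sum of a `₂F₁` series weighted by the values of a polynomial. -/
noncomputable def weightedHyp (a b c : ℂ) (P : Polynomial ℂ) (x : ℂ) : ℂ :=
  ∑' k, weightedHypCoeff a b c P k * x ^ k

theorem analyticOnNhd_weightedHyp (a b c : ℂ) (hc : ∀ l : ℕ, c ≠ -(l : ℂ)) (P : Polynomial ℂ) :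
    AnalyticOnNhd ℂ (weightedHyp a b c P) (Metric.ball 0 1) :=
  analyticOnNhd_tsum_mul_pow (summable_weightedHypCoeff a b c hc P)

theorem analyticOnNhd_one_sub_cpow (a : ℂ) :
    AnalyticOnNhd ℂ (fun x : ℂ => (1 - x) ^ a) (Metric.ball 0 1) := by
  intro x hx
  refine (analyticAt_const.sub analyticAt_id).cpow analyticAt_const ?_
  rw [sub_eq_add_neg]
  exact Complex.mem_slitPlane_of_norm_lt_one (by simpa using hx)

/-- Shows that the domain of Pfaff's transformation is convex, as the identity theorem needs it
connected. -/
theorem norm_div_sub_one_lt_one_iff {x : ℂ} (hx : ‖x‖ < 1) : ‖x / (x - 1)‖ < 1 ↔ x.re < 1 / 2 := by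
  have h1 : x - 1 ≠ 0 := fun h => by rw [sub_eq_zero.1 h] at hx; simp at hx
  rw [norm_div, div_lt_one (norm_pos_iff.2 h1), ← sq_lt_sq₀ (norm_nonneg _) (norm_nonneg _),
    ← Complex.normSq_eq_norm_sq, ← Complex.normSq_eq_norm_sq, Complex.normSq_apply,
    Complex.normSq_apply]
  simp only [Complex.sub_re, Complex.sub_im, Complex.one_re, Complex.one_im]
  constructor <;> intro h <;> nlinarith

/-! ### Pfaff's and Euler's transformations of functions. -/

theorem weightedHyp_pfaff_of_norm_lt_half (a b c : ℂ) {n : ℕ} (hc : ∀ l : ℕ, c ≠ -(l : ℂ))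
    (h : poch (c - b - n) n ≠ 0) {P : Polynomial ℂ} (hP : P.natDegree ≤ n) {x : ℂ}
    (hx : ‖x‖ < 1 / 2) :
    weightedHyp a b c P x =
      (1 - x) ^ (-a) * weightedHyp a (c - b - n) c (pfaffWeight b c n P) (x / (x - 1)) := by
  have hs := hasSum_pfaff_expansion a
    (summable_weightedHypCoeff a (c - b - n) c hc (pfaffWeight b c n P)) hx
  simp only [sum_antidiagonal_weightedHypCoeff a b c hc h hP] at hs
  exact hs.tsum_eq

/-- Pfaff's transformation for weighted `₂F₁` series. -/
theorem weightedHyp_pfaff (a b c : ℂ) {n : ℕ} (hc : ∀ l : ℕ, c ≠ -(l : ℂ))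
    (h : poch (c - b - n) n ≠ 0) {P : Polynomial ℂ} (hP : P.natDegree ≤ n) {x : ℂ}
    (hx : ‖x‖ < 1) (hx' : ‖x / (x - 1)‖ < 1) :
    weightedHyp a b c P x =
      (1 - x) ^ (-a) * weightedHyp a (c - b - n) c (pfaffWeight b c n P) (x / (x - 1)) := by
  let U : Set ℂ := Metric.ball 0 1 ∩ {w | w.re < 1 / 2}
  have hU : IsPreconnected U :=
    ((convex_ball 0 1).inter (convex_halfSpace_re_lt _)).isPreconnected
  have hL : AnalyticOnNhd ℂ (weightedHyp a b c P) U :=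
    (analyticOnNhd_weightedHyp a b c hc P).mono Set.inter_subset_left
  have hR : AnalyticOnNhd ℂ (fun x => (1 - x) ^ (-a) *
      weightedHyp a (c - b - n) c (pfaffWeight b c n P) (x / (x - 1))) U := by
    refine ((analyticOnNhd_one_sub_cpow (-a)).mono Set.inter_subset_left).mul ?_
    rintro w ⟨hw, hw'⟩
    have hw1 : w - 1 ≠ 0 := fun h => by
      rw [sub_eq_zero.1 h] at hw'; norm_num at hw'
    refine AnalyticAt.fun_comp (analyticOnNhd_weightedHyp _ _ c hc _ _ ?_)
      (analyticAt_id.div (analyticAt_id.sub analyticAt_const) hw1)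
    simp only [mem_ball_zero_iff] at hw ⊢
    exact (norm_div_sub_one_lt_one_iff hw).2 hw'
  refine hL.eqOn_of_preconnected_of_eventuallyEq hR hU (z₀ := 0) (by simp [U]) ?_
    ⟨by simpa using hx, (norm_div_sub_one_lt_one_iff hx).1 hx'⟩
  filter_upwards [Metric.ball_mem_nhds (0 : ℂ) (show (0 : ℝ) < 1 / 2 by norm_num)] with w hw
  exact weightedHyp_pfaff_of_norm_lt_half a b c hc h hP (by simpa using hw)

theorem weightedHyp_comm (a b c : ℂ) (P : Polynomial ℂ) (x : ℂ) :
    weightedHyp a b c P x = weightedHyp b a c P x := by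
  simp only [weightedHyp, weightedHypCoeff, mul_comm (poch a _)]

/-- Euler's transformation for weighted `₂F₁` series. -/
theorem weightedHyp_euler (a b c : ℂ) {n : ℕ} (hc : ∀ l : ℕ, c ≠ -(l : ℂ))
    (ha : poch (c - a - n) n ≠ 0) (hb : poch (c - b - n) n ≠ 0) {P : Polynomial ℂ}
    (hP : P.natDegree ≤ n) {x : ℂ} (hx : ‖x‖ < 1) :
    weightedHyp a b c P x = (1 - x) ^ (c - a - b - n) *
      weightedHyp (c - a - n) (c - b - n) c (pfaffWeight a c n (pfaffWeight b c n P)) x := by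
  refine (analyticOnNhd_weightedHyp a b c hc P).eqOn_of_preconnected_of_eventuallyEq
    ((analyticOnNhd_one_sub_cpow _).mul (analyticOnNhd_weightedHyp (c - a - n) (c - b - n) c hc _))
    (convex_ball 0 1).isPreconnected (z₀ := 0) (by simp) ?_ (by simpa using hx)
  filter_upwards [Metric.ball_mem_nhds (0 : ℂ) (show (0 : ℝ) < 1 / 2 by norm_num)] with w hw
  rw [mem_ball_zero_iff] at hw
  have hw1 : ‖w‖ < 1 := by linarith
  have hre : w.re < 1 / 2 := (Complex.re_le_norm w).trans_lt hw
  have hy := (norm_div_sub_one_lt_one_iff hw1).2 hre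
  have h0 : w - 1 ≠ 0 := fun h => by rw [sub_eq_zero.1 h] at hw; norm_num at hw
  have h0' : 1 - w ≠ 0 := fun h => h0 (by linear_combination -h)
  -- The map `w ↦ w / (w - 1)` is an involution, so a second Pfaff step, in the other upper
  -- parameter, returns to `w`.
  have hinv : w / (w - 1) / (w / (w - 1) - 1) = w := by
    rw [show w / (w - 1) - 1 = 1 / (w - 1) by field_simp; ring]
    field_simp
  have hinv' : 1 - w / (w - 1) = (1 - w)⁻¹ := by
    refine eq_inv_of_mul_eq_one_left ?_
    field_simp
    ring
  -- Off the branch cut, the principal power of `(1 - w)⁻¹` is the inverse of that of `1 - w`.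
  have harg : (1 - w).arg ≠ Real.pi := by
    refine (Complex.mem_slitPlane_iff_arg.1 ?_).1
    rw [sub_eq_add_neg]
    exact Complex.mem_slitPlane_of_norm_lt_one (by simpa using hw1)
  rw [weightedHyp_pfaff a b c hc hb hP hw1 hy, weightedHyp_comm,
    weightedHyp_pfaff (c - b - n) a c hc ha (natDegree_pfaffWeight_le b c n P) hy
      (by rwa [hinv]), hinv, hinv', weightedHyp_comm _ (c - a - n), Complex.inv_cpow _ _ harg,
    Complex.cpow_neg _ (c - b - n), inv_inv, ← mul_assoc, ← Complex.cpow_add _ _ h0']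
  congr 2
  ring

/-! ### From weights back to parameters. -/

open Polynomial in
/-- The polynomial with the values `shiftFactor e m k`. -/
noncomputable def shiftPolynomial {r : ℕ} (e : Fin r → ℂ) (m : Fin r → ℕ) : Polynomial ℂ :=
  ∏ i, C (poch (e i) (m i))⁻¹ * (ascPochhammer ℂ (m i)).comp (X + C (e i))

theorem shiftPolynomial_eval {r : ℕ} (e : Fin r → ℂ) (m : Fin r → ℕ) (z : ℂ) :
    (shiftPolynomial e m).eval z = ∏ i, poch (e i + z) (m i) / poch (e i) (m i) := by
  rw [shiftPolynomial, Polynomial.eval_prod]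
  refine Finset.prod_congr rfl fun i _ => ?_
  simp [Polynomial.eval_comp, poch, add_comm z, div_eq_inv_mul]

theorem natDegree_shiftPolynomial_le {r : ℕ} (e : Fin r → ℂ) (m : Fin r → ℕ) :
    (shiftPolynomial e m).natDegree ≤ ∑ i, m i := by
  refine (Polynomial.natDegree_prod_le _ _).trans (Finset.sum_le_sum fun i _ => ?_)
  refine (Polynomial.natDegree_C_mul_le _ _).trans ?_
  rw [Polynomial.natDegree_comp, Polynomial.natDegree_X_add_C, ascPochhammer_natDegree, mul_one]

theorem shiftedHypTerm_eq {r : ℕ} (a b c : ℂ) {e : Fin r → ℂ} {m : Fin r → ℕ} {P : Polynomial ℂ}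
    (h : ∀ k : ℕ, shiftFactor e m k = P.eval (k : ℂ)) (x : ℂ) :
    shiftedHypTerm a b c e m x = fun k => weightedHypCoeff a b c P k * x ^ k := by
  funext k
  rw [shiftedHypTerm, h, weightedHypCoeff]

theorem shiftedHyp_eq_weightedHyp {r : ℕ} (a b c : ℂ) {e : Fin r → ℂ} {m : Fin r → ℕ}
    {P : Polynomial ℂ} (h : ∀ k : ℕ, shiftFactor e m k = P.eval (k : ℂ)) (x : ℂ) :
    shiftedHyp a b c e m x = weightedHyp a b c P x := by
  rw [shiftedHyp, shiftedHypTerm_eq a b c h, weightedHyp]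

-- The condition `Q 0 = 1` does two things: it keeps the roots away from zero and, on dividing by `Q
-- 0`, cancels the leading coefficient.
open Polynomial in
theorem exists_shiftFactor_eq_eval {n : ℕ} {Q : Polynomial ℂ} (hd : Q.natDegree ≤ n)
    (hn : Q.coeff n ≠ 0) (h0 : Q.eval 0 = 1) :
    ∃ f : Fin n → ℂ, (∀ j, f j ≠ 0) ∧
      ∀ k : ℕ, shiftFactor f (fun _ => 1) k = Q.eval (k : ℂ) := by
  have hdeg : Q.natDegree = n := le_antisymm hd (le_natDegree_of_ne_zero hn)
  have hs := IsAlgClosed.splits Q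
  have hcard : Q.roots.card = n := by rw [← hs.natDegree_eq_card_roots, hdeg]
  obtain ⟨l, hl⟩ := Quot.exists_rep Q.roots
  have hl' : (l : Multiset ℂ) = Q.roots := hl
  have hlen : l.length = n := by rw [← hcard, ← hl', Multiset.coe_card]
  subst hlen
  have heval : ∀ z : ℂ, Q.eval z = Q.leadingCoeff * ∏ i : Fin l.length, (z - l[i]) := by
    intro z
    conv_lhs => rw [hs.eq_prod_roots, ← hl']
    simp only [Multiset.map_coe, Multiset.prod_coe, eval_mul, eval_C, eval_list_prod, List.map_map]
    simp [Function.comp_def]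
  have hroot : ∀ i : Fin l.length, -l[i] ≠ 0 := by
    intro i hi
    rw [heval, Finset.prod_eq_zero (Finset.mem_univ i) (by simpa using hi), mul_zero] at h0
    exact zero_ne_one h0
  refine ⟨fun i => -l[i], hroot, fun k => ?_⟩
  rw [← div_one (Q.eval (k : ℂ)), ← h0, heval, heval,
    mul_div_mul_left _ _ (by rw [leadingCoeff, hdeg]; exact hn), ← Finset.prod_div_distrib,
    shiftFactor]
  refine Finset.prod_congr rfl fun i _ => ?_
  simp [poch, sub_eq_neg_add]

/-- Identifies `D` as what governs the top coefficient after the second Pfaff step; the signs from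
the weight and from the falling factorial at `-α` cancel. -/
theorem pfaffWeight_shiftPolynomial_eval_neg {r : ℕ} (α β γ : ℂ) (e : Fin r → ℂ) (m : Fin r → ℕ) :
    (pfaffWeight β γ (∑ i, m i) (shiftPolynomial e m)).eval (-α) =
      eulerDiscriminant α β γ e m /
        poch (γ - β - ((∑ i, m i : ℕ) : ℂ)) (∑ i, m i) := by
  rw [pfaffWeight_eval, eulerDiscriminant]
  congr 1
  refine Finset.sum_congr rfl fun j _ => ?_
  have h1 : newtonCoeff (shiftPolynomial e m) j =
      (fwdDiff 1)^[j] (shiftFactor e m) 0 / (j.factorial : ℂ) := by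
    simp only [newtonCoeff, shiftPolynomial_eval]
    rfl
  have h2 : ((-1 : ℂ) ^ j) * (-1) ^ j = 1 := by rw [← mul_pow]; simp
  rw [h1, descPochhammer_eval_neg, show γ - β - ((∑ i, m i : ℕ) : ℂ) + -α =
    γ - α - β - ((∑ i, m i : ℕ) : ℂ) by ring]
  linear_combination ((fwdDiff 1)^[j] (shiftFactor e m) 0 / (j.factorial : ℂ) * poch α j *
    poch β j * poch (γ - α - β - ((∑ i, m i : ℕ) : ℂ)) (∑ i, m i - j)) * h2

theorem mainTheorem4 {r : ℕ} (α β γ : ℂ) (e : Fin r → ℂ) (m : Fin r → ℕ) (n : ℕ)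
    (hm : ∀ i, 0 < m i) (hn : n = ∑ i, m i)
    (he : ∀ i, poch (e i) (m i) ≠ 0)
    (hγ : ∀ l : ℕ, γ ≠ -(l : ℂ))
    (hβ : poch (γ - β - n) n ≠ 0) :
    (poch (γ - α - n) n ≠ 0 → eulerDiscriminant α β γ e m ≠ 0 →
      ∃ f : Fin n → ℂ, (∀ j, f j ≠ 0) ∧ ∀ x : ℂ, ‖x‖ < 1 →
        Summable (shiftedHypTerm α β γ e m x) ∧
        Summable (shiftedHypTerm (γ - α - n) (γ - β - n) γ f (fun _ => 1) x) ∧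
        shiftedHyp α β γ e m x =
          (1 - x) ^ (γ - α - β - n) *
            shiftedHyp (γ - α - n) (γ - β - n) γ f (fun _ => 1) x) ∧
    ((∀ i, poch (e i - β) (m i) ≠ 0) →
      ∃ f : Fin n → ℂ, (∀ j, f j ≠ 0) ∧ ∀ x : ℂ, ‖x‖ < 1 → ‖x / (x - 1)‖ < 1 →
        Summable (shiftedHypTerm α β γ e m x) ∧
        Summable (shiftedHypTerm α (γ - β - n) γ f (fun _ => 1) (x / (x - 1))) ∧
        shiftedHyp α β γ e m x =
          (1 - x) ^ (-α) *
            shiftedHyp α (γ - β - n) γ f (fun _ => 1) (x / (x - 1))) := by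
  subst hn
  have hP := natDegree_shiftPolynomial_le e m
  have hPk : ∀ k : ℕ, shiftFactor e m k = (shiftPolynomial e m).eval (k : ℂ) := fun k => by
    rw [shiftPolynomial_eval, shiftFactor]
  have hP0 : (shiftPolynomial e m).eval 0 = 1 := by
    rw [shiftPolynomial_eval]
    exact Finset.prod_eq_one fun i _ => by rw [add_zero, div_self (he i)]
  have hQ := natDegree_pfaffWeight_le β γ (∑ i, m i) (shiftPolynomial e m)
  have hQ0 := (pfaffWeight_eval_zero hβ (shiftPolynomial e m)).trans hP0
  constructor
  · intro hα hD
    obtain ⟨f, hf, hfk⟩ := exists_shiftFactor_eq_eval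
      (natDegree_pfaffWeight_le α γ _ (pfaffWeight β γ (∑ i, m i) (shiftPolynomial e m)))
      (by
        rw [pfaffWeight_coeff α γ hQ, pfaffWeight_shiftPolynomial_eval_neg]
        exact div_ne_zero (div_ne_zero hD hβ) hα)
      ((pfaffWeight_eval_zero hα _).trans hQ0)
    refine ⟨f, hf, fun x hx => ⟨?_, ?_, ?_⟩⟩
    · rw [shiftedHypTerm_eq α β γ hPk]
      exact summable_weightedHypCoeff α β γ hγ _ x hx
    · rw [shiftedHypTerm_eq _ _ γ hfk]
      exact summable_weightedHypCoeff _ _ γ hγ _ x hx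
    · rw [shiftedHyp_eq_weightedHyp α β γ hPk, shiftedHyp_eq_weightedHyp _ _ γ hfk]
      exact weightedHyp_euler α β γ hγ hα hβ hP hx
  · intro heβ
    obtain ⟨f, hf, hfk⟩ := exists_shiftFactor_eq_eval hQ
      (by
        -- The top coefficient is a nonzero multiple of `∏ (e_i - β)_{m_i}`.
        rw [pfaffWeight_coeff β γ hP, shiftPolynomial_eval]
        exact div_ne_zero (Finset.prod_ne_zero_iff.2 fun i _ =>
          div_ne_zero (by rw [← sub_eq_add_neg]; exact heβ i) (he i)) hβ) hQ0
    refine ⟨f, hf, fun x hx hx' => ⟨?_, ?_, ?_⟩⟩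
    · rw [shiftedHypTerm_eq α β γ hPk]
      exact summable_weightedHypCoeff α β γ hγ _ x hx
    · rw [shiftedHypTerm_eq _ _ γ hfk]
      exact summable_weightedHypCoeff _ _ γ hγ _ _ hx'
    · rw [shiftedHyp_eq_weightedHyp α β γ hPk, shiftedHyp_eq_weightedHyp _ _ γ hfk]
      exact weightedHyp_pfaff α β γ hγ hβ hP hx hx'
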